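/- Let $V\ge 1$ and let the interfering devices $x_1,x_2,\dots$ form a homogeneous Poisson point process of intensity $\lambda>0$ in the plane $\mathbb R^2$. Independently of the locations, the devices carry i.i.d. types in $\{1,\dots,V\}$ with probability mass function $f$; write $\Psi_v$ for the set of devices of type $v$, $\Psi$ for the resulting marked point process (locations together with types), and $\lambda_v=f(v)\lambda$. Devices of type $v$ transmit with power $p_v>0$ and, independently of each other, are active with probability $\alpha_v\in[0,1]$; let $\mathbf 1_{\xi_i}$ be the activity indicator of the device $x_i$. The test receiver is at the origin, and its transmitter, of power $p_o>0$, is at a fixed point $x_o$ with $\|x_o\|=R_o>0$. Path loss is $r^{-\eta}$ with $\eta>2$. Under Rayleigh fading the power gains $h_o,h_1,h_2,\dots$ of the intended and interfering channels are i.i.d. exponential with mean $1$, independent of locations, types and activities. For a detection threshold $\theta_n>0$ let $$\mathrm p_n=\mathbb P\left\{\frac{p_o h_o\|x_o\|^{-\eta}}{\sum_{v=1}^{V}\sum_{x_i\in\Psi_v\setminus x_o}\mathbf 1_{\xi_i}\,p_v h_i\|x_i\|^{-\eta}}\ge\theta_n\;\Big|\;\Psi\right\}$$ be the conditional fragment success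 delivery probability given $\Psi$ (the ratio is $+\infty$ when a positive signal meets no interference). Then its moments $M_1=\mathbb E[\mathrm p_n]$ and $M_2=\mathbb E[\mathrm p_n^2]$ are $$M_1=\exp\left[-\frac{2\pi^2R_o^2\,\theta_n^{2/\eta}}{\eta\sin(2\pi/\eta)}\sum_{v=1}^{V}\left(\frac{p_v}{p_o}\right)^{2/\eta}\lambda_v\alpha_v\right],$$ $$M_2=\exp\left[-\frac{2\pi^2R_o^2\,\theta_n^{2/\eta}}{\eta\sin(2\pi/\eta)}\sum_{v=1}^{V}\left(\frac{p_v}{p_o}\right)^{2/\eta}\lambda_v\alpha_v\left(2-\alpha_v\left(1-\frac2\eta\right)\right)\right].$$ -/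

import Mathlib

open MeasureTheory ProbabilityTheory
open scoped ENNReal NNReal

noncomputable section

/-- The Euclidean plane. -/
abbrev Plane : Type := EuclideanSpace ℝ (Fin 2)

/-- The random measure `N` is a Poisson point process with intensity measure `μ` under the
probability measure `P`: the number of points in a set `B` of finite intensity is Poisson
distributed with mean `μ B`, and the numbers of points in disjoint sets are independent. -/
structure IsPoissonPointProcess {Ω E : Type*} [MeasurableSpace Ω] [MeasurableSpace E]
    (P : Measure Ω) (N : Ω → Measure E) (μ : Measure E) : Prop where
  measurable : Measurable N
  law : ∀ B : Set E, MeasurableSet B → μ B ≠ ∞ →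
    P.map (fun ω => N ω B) =
      (poissonMeasure (μ B).toNNReal).map (fun k : ℕ => (k : ℝ≥0∞))
  indep : ∀ (n : ℕ) (B : Fin n → Set E), (∀ j, MeasurableSet (B j)) →
    Pairwise (fun j k => Disjoint (B j) (B k)) →
    iIndepFun (fun j ω => N ω (B j)) P

/-- The random quantities of the network, seen from a test receiver at the origin:
the locations, types, activity indicators and channel gains of the interfering devices (numbered
by `ℕ`), and the channel gain of the intended link. -/
structure InterferenceField (Ω : Type*) (V : ℕ) where
  /-- location of the `i`-th interfering device -/
  loc : ℕ → Ω → Plane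
  /-- type (mark) of the `i`-th interfering device -/
  type : ℕ → Ω → Fin V
  /-- whether the `i`-th interfering device is active -/
  active : ℕ → Ω → Bool
  /-- power gain of the channel from the `i`-th interfering device to the receiver -/
  gain : ℕ → Ω → ℝ
  /-- power gain of the channel of the intended link -/
  gain₀ : Ω → ℝ

namespace InterferenceField

variable {Ω : Type*} {V : ℕ}

/-- The point process of the locations of the interfering devices, as a counting measure. -/
def locCounting (F : InterferenceField Ω V) (ω : Ω) : Measure Plane :=
  Measure.sum fun i => Measure.dirac (F.loc i ω)

/-- The marked point process of the locations and types of the interfering devices, as a counting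
measure. -/
def markedCounting (F : InterferenceField Ω V) (ω : Ω) : Measure (Plane × Fin V) :=
  Measure.sum fun i => Measure.dirac (F.loc i ω, F.type i ω)

/-- Heterogeneous Poisson field of interferers with Rayleigh fading: the locations form a
homogeneous Poisson point process of intensity `lam`; independently of the locations, the devices
are independently marked, with type `v` of probability `f v`; a device of type `v` is active with
probability `α v`; all power gains are exponential of mean one, independent of each other and
of everything else. -/
structure IsPoissonRayleigh [MeasurableSpace Ω] (F : InterferenceField Ω V) (P : Measure Ω)
    (lam : ℝ) (f α : Fin V → ℝ) : Prop where
  measurable_loc : ∀ i, Measurable (F.loc i)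
  measurable_type : ∀ i, Measurable (F.type i)
  measurable_active : ∀ i, Measurable (F.active i)
  measurable_gain : ∀ i, Measurable (F.gain i)
  measurable_gain₀ : Measurable F.gain₀
  poisson : IsPoissonPointProcess P F.locCounting (ENNReal.ofReal lam • (volume : Measure Plane))
  law_type : ∀ i v, P.real {ω | F.type i ω = v} = f v
  law_active : ∀ i v, P.real {ω | F.type i ω = v ∧ F.active i ω = true} = f v * α v
  law_gain : ∀ i, P.map (F.gain i) = expMeasure 1
  law_gain₀ : P.map F.gain₀ = expMeasure 1
  indep_gain : ∀ i, IndepFun (F.gain i) (fun ω => (F.type i ω, F.active i ω)) P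
  iIndep_marks : iIndepFun (fun i ω => (F.type i ω, F.active i ω, F.gain i ω)) P
  indep_loc : IndepFun (fun ω i => F.loc i ω)
    (fun ω i => (F.type i ω, F.active i ω, F.gain i ω)) P
  indep_gain₀ : IndepFun F.gain₀
    (fun ω i => (F.loc i ω, F.type i ω, F.active i ω, F.gain i ω)) P

open Classical in
/-- The interference power at the origin, with path-loss exponent `η` and transmission power `p v`
of type `v`: the sum over the types `v` and over the active devices of type `v` other than the
intended transmitter `x₀`. -/
def interference (F : InterferenceField Ω V) (η : ℝ) (p : Fin V → ℝ) (x₀ : Plane) (ω : Ω) :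
    ℝ≥0∞ :=
  ∑ v : Fin V, ∑' i : ℕ,
    if F.type i ω = v ∧ F.loc i ω ≠ x₀ ∧ F.active i ω = true then
      ENNReal.ofReal (p v) * ENNReal.ofReal (F.gain i ω) * ‖F.loc i ω‖ₑ ^ (-η)
    else 0

/-- The signal-to-interference ratio at the origin for an intended transmitter at `x₀` with power
`p₀`. It takes values in `[0, ∞]`; it is `∞` if a positive signal meets no interference. -/
def sir (F : InterferenceField Ω V) (η : ℝ) (p : Fin V → ℝ) (p₀ : ℝ) (x₀ : Plane) (ω : Ω) :
    ℝ≥0∞ :=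
  ENNReal.ofReal p₀ * ENNReal.ofReal (F.gain₀ ω) * ‖x₀‖ₑ ^ (-η) / F.interference η p x₀ ω

/-- The fragment success delivery probability: the conditional probability of `sir ≥ θ` given the
marked point process of the interfering devices. -/
def fsdProb [MeasurableSpace Ω] (F : InterferenceField Ω V) (P : Measure Ω) (η : ℝ)
    (p : Fin V → ℝ) (p₀ : ℝ) (x₀ : Plane) (θ : ℝ) : Ω → ℝ :=
  condExp (MeasurableSpace.comap F.markedCounting inferInstance) P
    ({ω | ENNReal.ofReal θ ≤ F.sir η p p₀ x₀ ω}.indicator fun _ => (1 : ℝ))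

end InterferenceField

end

/-! ### The function `exp (-t)` on `[0, ∞]` and infinite products of independent factors. -/

noncomputable section

/-! Let I be the interference and κ = θ / (p₀ ‖x₀‖^(-η)). Success means that the intended gain is at
least κ I. Averaging over this exponential gain gives E[exp (-κ I) | Ψ], and averaging over
activities and gains, independent from device to device, turns this into a product over devices of
s_v(x) = 1 - α_v / (1 + ‖x‖^η / c_v), where c_v = θ (p_v / p₀) ‖x₀‖^η (`fsdProb_ae_eq`).

The k-th power of the product is again a product. Averaging over the independent types replaces each
factor by ∑ f(v) s_v(x)^k, a function of the location alone, so the Laplace functional of the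
Poisson process of locations (`IsPoissonPointProcess.lintegral_negExp`) gives exp (-λ ∑ f(v) ∫ (1 -
s_v^k)) (`moment_fsdProb`). For k = 1, 2 the integrals are combinations of those of u and u², with u
= 1 / (1 + ‖x‖^η / c); these are Gamma integrals, whose values follow from the reflection formula
and Γ(s + 1) = s Γ(s).

Everything up to the plane integrals is done in `[0, ∞]`, with infinite products as infima of
partial products, so neither finiteness of I nor convergence needs a separate argument. -/

/-- The map `t ↦ exp (-t)` on `[0, ∞]`, with value `0` at `∞`. -/
def negExp (t : ℝ≥0∞) : ℝ≥0∞ := EReal.exp (-(t : EReal))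

/-- The map `y ↦ -log y` on `[0, 1]`, extended by `0` to `[1, ∞]`. -/
def negLog (y : ℝ≥0∞) : ℝ≥0∞ := (-(ENNReal.log y)).toENNReal

lemma continuous_negExp : Continuous negExp :=
  ENNReal.continuous_exp.comp (continuous_neg.comp continuous_coe_ennreal_ereal)

@[fun_prop]
lemma measurable_negExp : Measurable negExp := continuous_negExp.measurable

@[fun_prop]
lemma measurable_negLog : Measurable negLog :=
  measurable_ereal_toENNReal.comp (continuous_neg.measurable.comp ENNReal.measurable_log)

lemma antitone_negExp : Antitone negExp := fun _ _ h =>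
  EReal.exp_monotone (EReal.neg_le_neg_iff.2 (EReal.coe_ennreal_le_coe_ennreal_iff.2 h))

@[simp] lemma negExp_zero : negExp 0 = 1 := by simp [negExp]

@[simp] lemma negExp_top : negExp ∞ = 0 := by simp [negExp]

lemma negExp_le_one (t : ℝ≥0∞) : negExp t ≤ 1 := negExp_zero ▸ antitone_negExp zero_le

lemma negExp_ne_top (t : ℝ≥0∞) : negExp t ≠ ∞ := ((negExp_le_one t).trans_lt ENNReal.one_lt_top).ne

lemma negExp_add (s t : ℝ≥0∞) : negExp (s + t) = negExp s * negExp t := by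
  rw [negExp, EReal.coe_ennreal_add, EReal.neg_add (by simp) (by simp), sub_eq_add_neg,
    EReal.exp_add]
  rfl

lemma negExp_ofReal {x : ℝ} (hx : 0 ≤ x) :
    negExp (ENNReal.ofReal x) = ENNReal.ofReal (Real.exp (-x)) := by
  rw [negExp, EReal.coe_ennreal_ofReal, max_eq_left hx, ← EReal.coe_neg, EReal.exp_coe]

lemma negExp_negLog {y : ℝ≥0∞} (hy : y ≤ 1) : negExp (negLog y) = y := by
  have h : ENNReal.log y ≤ 0 := by
    rw [← ENNReal.log_one]
    exact ENNReal.log_monotone hy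
  rw [negExp, negLog, EReal.coe_toENNReal (EReal.neg_nonneg.2 h), neg_neg, ENNReal.exp_log]

lemma negExp_sum {ι : Type*} (s : Finset ι) (t : ι → ℝ≥0∞) :
    negExp (∑ i ∈ s, t i) = ∏ i ∈ s, negExp (t i) := by
  classical
  induction s using Finset.induction_on with
  | empty => simp
  | insert a s ha ih => rw [Finset.sum_insert ha, Finset.prod_insert ha, negExp_add, ih]

lemma negExp_nat_mul (k : ℕ) (t : ℝ≥0∞) : negExp (k * t) = negExp t ^ k := by
  simpa [nsmul_eq_mul] using negExp_sum (Finset.range k) fun _ => t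

lemma negExp_iSup {ι : Type*} [Nonempty ι] (t : ι → ℝ≥0∞) :
    negExp (⨆ i, t i) = ⨅ i, negExp (t i) :=
  antitone_negExp.map_ciSup_of_continuousAt continuous_negExp.continuousAt

/-- The infinite product of a sequence in `[0, 1]`, as the infimum of the partial products. -/
def infProd (y : ℕ → ℝ≥0∞) : ℝ≥0∞ := ⨅ n, ∏ i ∈ Finset.range n, y i

lemma negExp_tsum (t : ℕ → ℝ≥0∞) : negExp (∑' i, t i) = infProd fun i => negExp (t i) := by
  simp_rw [ENNReal.tsum_eq_iSup_nat, negExp_iSup, negExp_sum, infProd]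

/-- Taking `-log` turns the product into a sum, hence later into an integral against a counting
measure. A vanishing factor contributes `∞` to the sum. -/
lemma infProd_eq_negExp {y : ℕ → ℝ≥0∞} (hy : ∀ i, y i ≤ 1) :
    infProd y = negExp (∑' i, negLog (y i)) := by
  simp_rw [negExp_tsum, negExp_negLog (hy _)]

lemma infProd_pow {y : ℕ → ℝ≥0∞} (hy : ∀ i, y i ≤ 1) (k : ℕ) :
    infProd y ^ k = infProd fun i => y i ^ k := by
  rw [infProd_eq_negExp hy, ← negExp_nat_mul, ← ENNReal.tsum_mul_left, negExp_tsum]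
  simp_rw [negExp_nat_mul, negExp_negLog (hy _)]

lemma infProd_le_one (y : ℕ → ℝ≥0∞) : infProd y ≤ 1 :=
  (iInf_le _ 0).trans_eq (by simp)

lemma infProd_eq_zero {y : ℕ → ℝ≥0∞} {i : ℕ} (hi : y i = 0) : infProd y = 0 :=
  le_antisymm ((iInf_le _ (i + 1)).trans_eq
    (Finset.prod_eq_zero (Finset.self_mem_range_succ i) hi)) zero_le

@[fun_prop]
lemma Measurable.infProd {𝓧 : Type*} [MeasurableSpace 𝓧] {Y : 𝓧 → ℕ → ℝ≥0∞}
    (hY : ∀ i, Measurable fun x => Y x i) : Measurable fun x => infProd (Y x) :=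
  Measurable.iInf fun _ => Finset.measurable_prod _ fun i _ => hY i

/-- The expectation of an infinite product of independent random variables with values in `[0, 1]`
is the product of the expectations. -/
lemma lintegral_infProd_infinitePi {𝓩 : Type*} [MeasurableSpace 𝓩] (ν : ℕ → Measure 𝓩)
    [∀ i, IsProbabilityMeasure (ν i)] {Y : ℕ → 𝓩 → ℝ≥0∞} (hY : ∀ i, Measurable (Y i))
    (hY1 : ∀ i z, Y i z ≤ 1) :
    ∫⁻ z, infProd (fun i => Y i (z i)) ∂(Measure.infinitePi ν) =
      infProd fun i => ∫⁻ z, Y i z ∂(ν i) := by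
  have hanti : Antitone fun n (z : ℕ → 𝓩) => ∏ i ∈ Finset.range n, Y i (z i) := by
    refine antitone_nat_of_succ_le fun n z => ?_
    simp only [Finset.prod_range_succ]
    exact mul_le_of_le_one_right' (hY1 _ _)
  have hmeas : ∀ n, Measurable fun z : ℕ → 𝓩 => ∏ i ∈ Finset.range n, Y i (z i) := fun n => by
    fun_prop
  simp_rw [infProd]
  -- The partial products decrease from the empty product 1, so monotone convergence applies;
  -- independence then handles each finite product.
  rw [lintegral_iInf hmeas hanti (by simp)]
  congr with n
  have hind : iIndepFun (fun i (z : ℕ → 𝓩) => Y i (z i)) (Measure.infinitePi ν) :=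
    iIndepFun_infinitePi hY
  rw [lintegral_prod_eq_prod_lintegral_of_indepFun (Finset.range n) _ hind fun i => by fun_prop]
  refine Finset.prod_congr rfl fun i _ => ?_
  rw [← (measurePreserving_eval_infinitePi ν i).map_eq, lintegral_map (hY i) (by fun_prop)]

/-- Conditioning an infinite product of functions of independent random variables on the values
of a function `τ` of each of them. -/
lemma setLIntegral_infProd_infinitePi {𝓩 𝓣 : Type*} [MeasurableSpace 𝓩] [MeasurableSpace 𝓣]
    (ν : ℕ → Measure 𝓩) [∀ i, IsProbabilityMeasure (ν i)] {τ : 𝓩 → 𝓣} (hτ : Measurable τ)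
    {Y : ℕ → 𝓩 → ℝ≥0∞} (hY : ∀ i, Measurable (Y i)) (hY1 : ∀ i z, Y i z ≤ 1)
    {G : ℕ → 𝓣 → ℝ≥0∞} (hG : ∀ i, Measurable (G i)) (hG1 : ∀ i t, G i t ≤ 1)
    (h : ∀ i C, MeasurableSet C →
      ∫⁻ z in τ ⁻¹' C, Y i z ∂(ν i) = ∫⁻ z in τ ⁻¹' C, G i (τ z) ∂(ν i))
    {C : Set (ℕ → 𝓣)} (hC : MeasurableSet C) :
    ∫⁻ z in (fun z i => τ (z i)) ⁻¹' C, infProd (fun i => Y i (z i)) ∂(Measure.infinitePi ν) =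
      ∫⁻ z in (fun z i => τ (z i)) ⁻¹' C, infProd (fun i => G i (τ (z i)))
        ∂(Measure.infinitePi ν) := by
  have hτ' : Measurable fun (z : ℕ → 𝓩) i => τ (z i) := by fun_prop
  -- The indicator of a box is absorbed factor by factor: outside the box some factor vanishes, and
  -- with it the product.
  have key : ∀ (W : ℕ → 𝓩 → ℝ≥0∞), (∀ i, Measurable (W i)) → (∀ i z, W i z ≤ 1) →
      ∀ t : ℕ → Set 𝓣, (∀ i, MeasurableSet (t i)) →
      ∫⁻ z in (fun z i => τ (z i)) ⁻¹' (Set.univ.pi t), infProd (fun i => W i (z i))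
        ∂(Measure.infinitePi ν) = infProd fun i => ∫⁻ z in τ ⁻¹' t i, W i z ∂(ν i) := by
    intro W hW hW1 t ht
    simp_rw [← lintegral_indicator (hτ (ht _))]
    rw [← lintegral_infProd_infinitePi ν (fun i => (hW i).indicator (hτ (ht i))) fun i z =>
      (Set.indicator_le_self _ _ _).trans (hW1 i z),
      ← lintegral_indicator (hτ' (MeasurableSet.univ_pi ht))]
    congr with z
    by_cases hz : z ∈ (fun z i => τ (z i)) ⁻¹' (Set.univ.pi t)
    · rw [Set.indicator_of_mem hz]
      congr with i
      rw [Set.indicator_of_mem]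
      exact hz i trivial
    · rw [Set.indicator_of_notMem hz]
      simp only [Set.mem_preimage, Set.mem_pi, Set.mem_univ, true_imp_iff, not_forall] at hz
      obtain ⟨i, hi⟩ := hz
      exact (infProd_eq_zero (i := i) (Set.indicator_of_notMem (s := τ ⁻¹' t i) hi _)).symm
  have hfin : ∀ W : ℕ → 𝓩 → ℝ≥0∞, IsFiniteMeasure
      ((Measure.infinitePi ν).withDensity fun z => infProd fun i => W i (z i)) := fun W =>
    isFiniteMeasure_withDensity (((lintegral_mono fun z => infProd_le_one _).trans_lt
      (by simp)).ne)
  -- Both sides, as functions of the event `C`, are finite measures on sequences, so agreement on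
  -- cylinders and on the whole space suffices.
  have heq : ((Measure.infinitePi ν).withDensity fun z => infProd fun i => Y i (z i)).map
        (fun z i => τ (z i)) =
      ((Measure.infinitePi ν).withDensity fun z => infProd fun i => G i (τ (z i))).map
        (fun z i => τ (z i)) := by
    have := hfin Y
    have := hfin fun i z => G i (τ z)
    refine ext_of_generate_finite _ generateFrom_squareCylinders.symm
      (isPiSystem_squareCylinders (fun _ => MeasurableSpace.isPiSystem_measurableSet) (by simp))
      ?_ ?_
    · classical
      rintro _ ⟨s, t, ht, rfl⟩
      rw [← Set.univ_pi_ite]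
      replace ht : ∀ i, MeasurableSet (if i ∈ (s : Set ℕ) then t i else Set.univ) := fun i => by
        split_ifs
        exacts [ht i trivial, .univ]
      have htm := hτ' (MeasurableSet.univ_pi ht)
      rw [Measure.map_apply hτ' (.univ_pi ht), Measure.map_apply hτ' (.univ_pi ht),
        withDensity_apply _ htm, withDensity_apply _ htm, key Y hY hY1 _ ht,
        key (fun i z => G i (τ z)) (fun i => (hG i).comp hτ) (fun i z => hG1 _ _) _ ht]
      simp_rw [h _ _ (ht _)]
    · have h1 := key Y hY hY1 (fun _ => Set.univ) fun _ => .univ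
      have h2 := key (fun i z => G i (τ z)) (fun i => (hG i).comp hτ) (fun i z => hG1 _ _)
        (fun _ => Set.univ) fun _ => .univ
      simp_rw [h _ _ .univ] at h1
      rw [← h2] at h1
      rw [Measure.map_apply hτ' .univ, Measure.map_apply hτ' .univ, Set.preimage_univ,
        withDensity_apply _ .univ, withDensity_apply _ .univ]
      simpa using h1
  have := congrArg (fun m => m C) heq
  simpa only [Measure.map_apply hτ' hC, withDensity_apply _ (hτ' hC)] using this

end

/-! ### Exponential and Poisson distributions. -/

noncomputable section

lemma expMeasure_one_eq :
    expMeasure 1 = (volume.restrict (Set.Ioi 0)).withDensity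
      fun x => ENNReal.ofReal (Real.exp (-x)) := by
  rw [expMeasure, gammaMeasure, ← withDensity_indicator measurableSet_Ioi]
  refine withDensity_congr_ae ?_
  have h0 : ∀ᵐ x : ℝ, x ≠ 0 := by simp [ae_iff]
  filter_upwards [h0] with x hx
  change exponentialPDF 1 x = _
  rw [exponentialPDF_eq]
  rcases lt_or_gt_of_ne hx with h | h
  · simp [h.not_ge, h.le]
  · simp [h.le, h]

lemma lintegral_expMeasure_one {g : ℝ → ℝ≥0∞} (hg : Measurable g) :
    ∫⁻ h, g h ∂(expMeasure 1) =
      ∫⁻ x in Set.Ioi (0 : ℝ), ENNReal.ofReal (Real.exp (-x)) * g x := by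
  rw [expMeasure_one_eq, lintegral_withDensity_eq_lintegral_mul _ (by fun_prop) hg]
  rfl

lemma ae_pos_expMeasure_one : ∀ᵐ h ∂(expMeasure 1), 0 < h := by
  rw [expMeasure_one_eq]
  exact (withDensity_absolutelyContinuous _ _).ae_le (ae_restrict_mem measurableSet_Ioi)

/-- The tail of the exponential distribution. -/
lemma expMeasure_one_tail (t : ℝ≥0∞) :
    expMeasure 1 {h | t ≤ ENNReal.ofReal h} = negExp t := by
  have := isProbabilityMeasure_expMeasure one_pos
  induction t with
  | top => simp
  | coe t =>
    -- At `t = 0` the truncation in `ENNReal.ofReal` makes the set all of ℝ, not `Ici 0`.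
    rcases eq_or_ne t 0 with rfl | ht
    · simp
    have hset : {h : ℝ | (t : ℝ≥0∞) ≤ ENNReal.ofReal h} = Set.Ici (t : ℝ) := by
      ext h
      simp only [Set.mem_ofPred_eq, Set.mem_Ici]
      rw [← ENNReal.ofReal_coe_nnreal, ENNReal.ofReal_le_ofReal_iff']
      have : (0 : ℝ) < t := by positivity
      constructor
      · rintro (h | h) <;> linarith
      · exact Or.inl
    have ht' : (0 : ℝ) < t := by positivity
    rw [hset, expMeasure_one_eq, withDensity_apply _ measurableSet_Ici,
      Measure.restrict_restrict measurableSet_Ici,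
      Set.inter_eq_left.2 (show Set.Ici (t : ℝ) ⊆ Set.Ioi 0 from Set.Ici_subset_Ioi.2 ht'),
      setLIntegral_congr Ioi_ae_eq_Ici.symm, ← ofReal_integral_eq_lintegral_ofReal
        (integrableOn_exp_neg_Ioi _) (ae_of_all _ fun x => (Real.exp_pos _).le), integral_exp_neg_Ioi,
      ← ENNReal.ofReal_coe_nnreal, negExp_ofReal ht'.le]

/-- The Laplace transform of the exponential distribution. -/
lemma lintegral_negExp_mul_expMeasure_one {c : ℝ} (hc : 0 ≤ c) :
    ∫⁻ h, negExp (ENNReal.ofReal c * ENNReal.ofReal h) ∂(expMeasure 1) =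
      ENNReal.ofReal (1 / (1 + c)) := by
  rw [lintegral_expMeasure_one (by fun_prop)]
  have h1 : 0 < 1 + c := by linarith
  calc ∫⁻ x in Set.Ioi (0 : ℝ), ENNReal.ofReal (Real.exp (-x)) *
        negExp (ENNReal.ofReal c * ENNReal.ofReal x)
      = ∫⁻ x in Set.Ioi (0 : ℝ), ENNReal.ofReal (Real.exp (-(1 + c) * x)) := by
        refine setLIntegral_congr_fun measurableSet_Ioi fun x (hx : 0 < x) => ?_
        rw [← ENNReal.ofReal_mul hc, negExp_ofReal (by positivity), ← ENNReal.ofReal_mul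
          (Real.exp_pos _).le, ← Real.exp_add]
        ring_nf
    _ = ENNReal.ofReal (1 / (1 + c)) := by
        rw [← ofReal_integral_eq_lintegral_ofReal (integrableOn_exp_mul_Ioi (by linarith) _)
          (ae_of_all _ fun x => (Real.exp_pos _).le), integral_exp_mul_Ioi (by linarith)]
        rw [mul_zero, Real.exp_zero, neg_div_neg_eq]

/-- Integration of a function of two independent random variables. -/
lemma lintegral_comp_prodMk_of_indepFun {Ω 𝓧 𝓨 : Type*} [MeasurableSpace Ω] [MeasurableSpace 𝓧]
    [MeasurableSpace 𝓨] {P : Measure Ω} [IsProbabilityMeasure P] {X : Ω → 𝓧} {Y : Ω → 𝓨}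
    (hX : Measurable X) (hY : Measurable Y) (hXY : IndepFun X Y P) {g : 𝓧 × 𝓨 → ℝ≥0∞}
    (hg : Measurable g) :
    ∫⁻ ω, g (X ω, Y ω) ∂P = ∫⁻ x, ∫⁻ y, g (x, y) ∂(P.map Y) ∂(P.map X) := by
  have := Measure.isProbabilityMeasure_map (μ := P) hY.aemeasurable
  rw [← lintegral_map (μ := P) hg (hX.prodMk hY),
    (indepFun_iff_map_prod_eq_prod_map_map hX.aemeasurable hY.aemeasurable).1 hXY,
    lintegral_prod _ hg.aemeasurable]

/-- The Laplace transform of the Poisson distribution. -/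
lemma lintegral_negExp_mul_poissonMeasure (r : ℝ≥0) {a : ℝ≥0∞} :
    ∫⁻ k, negExp (a * (k : ℝ≥0∞)) ∂(poissonMeasure r) = negExp (r * (1 - negExp a)) := by
  -- The expectation is the Poisson generating function at b = exp (-a). For `a = ∞` one has b = 0,
  -- and the convention 0 ^ 0 = 1 leaves the probability of no points.
  obtain ⟨b, hb0, hb1, hb⟩ : ∃ b : ℝ, 0 ≤ b ∧ b ≤ 1 ∧ negExp a = ENNReal.ofReal b :=
    ⟨(negExp a).toReal, by simp, ENNReal.toReal_le_of_le_ofReal zero_le_one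
      (by simpa using negExp_le_one a), (ENNReal.ofReal_toReal (negExp_ne_top a)).symm⟩
  have hs : HasSum (fun k : ℕ => Real.exp (-r) * r ^ k / k.factorial * b ^ k)
      (Real.exp (-(r * (1 - b)))) := by
    convert! (NormedSpace.expSeries_div_hasSum_exp ((r : ℝ) * b)).mul_left (Real.exp (-r)) using 1
    · ext k
      rw [mul_pow]
      ring
    · rw [← Real.exp_eq_exp_ℝ, ← Real.exp_add]
      ring_nf
  have h1b : (r : ℝ≥0∞) * (1 - negExp a) = ENNReal.ofReal (r * (1 - b)) := by
    rw [hb, ENNReal.ofReal_mul r.coe_nonneg, ENNReal.ofReal_sub _ hb0]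
    simp
  rw [h1b, negExp_ofReal (mul_nonneg r.coe_nonneg (by linarith)), ← hs.tsum_eq,
    ENNReal.ofReal_tsum_of_nonneg (fun k => by positivity) hs.summable, poissonMeasure,
    lintegral_sum_measure]
  congr with k
  rw [lintegral_smul_measure, lintegral_dirac, mul_comm a, negExp_nat_mul, hb, smul_eq_mul,
    ← ENNReal.ofReal_pow hb0, ← ENNReal.ofReal_mul (by positivity)]

end

/-! ### The Laplace functional of a Poisson point process. -/

noncomputable section

namespace IsPoissonPointProcess

variable {Ω E : Type*} [MeasurableSpace Ω] [MeasurableSpace E] {P : Measure Ω}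
  {N : Ω → Measure E} {μ : Measure E}

lemma lintegral_negExp_mul (hN : IsPoissonPointProcess P N μ) {B : Set E} (hB : MeasurableSet B)
    (hμB : μ B ≠ ∞) (a : ℝ≥0∞) :
    ∫⁻ ω, negExp (a * N ω B) ∂P = negExp (μ B * (1 - negExp a)) := by
  have hmeas : Measurable fun ω => N ω B := (Measure.measurable_coe hB).comp hN.measurable
  have hneg : Measurable fun t : ℝ≥0∞ => negExp (a * t) := by fun_prop
  rw [← lintegral_map (f := fun t => negExp (a * t)) (g := fun ω => N ω B) hneg hmeas,
    hN.law B hB hμB, lintegral_map hneg (by fun_prop), lintegral_negExp_mul_poissonMeasure,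
    ENNReal.coe_toNNReal hμB]

/-- The integral of a simple function is a sum of values times counts of disjoint level sets. These
counts are independent and Poisson, so the Laplace transforms multiply. -/
lemma lintegral_negExp_simpleFunc (hN : IsPoissonPointProcess P N μ) (s : SimpleFunc E ℝ≥0∞)
    (hs : s.FinMeasSupp μ) :
    ∫⁻ ω, negExp (∫⁻ x, s x ∂(N ω)) ∂P = negExp (∫⁻ x, (1 - negExp (s x)) ∂μ) := by
  classical
  -- The level set of 0 may have infinite intensity; it contributes nothing to either integral.
  set R := s.range.erase 0
  have hR : ∀ (g : ℝ≥0∞ → ℝ≥0∞) (ν : Measure E), g 0 = 0 →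
      ∫⁻ x, g (s x) ∂ν = ∑ j : Fin R.card,
        g (R.equivFin.symm j) * ν (s ⁻¹' {(R.equivFin.symm j : ℝ≥0∞)}) := by
    intro g ν hg
    have h1 : ∫⁻ x, g (s x) ∂ν = (s.map g).lintegral ν :=
      SimpleFunc.lintegral_eq_lintegral (s.map g) ν
    rw [h1, SimpleFunc.map_lintegral, ← Finset.sum_erase _ (a := 0) (by simp [hg]),
      ← Finset.sum_coe_sort, ← R.equivFin.symm.sum_comp]
  have hind := hN.indep R.card (fun j => s ⁻¹' {(R.equivFin.symm j : ℝ≥0∞)})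
    (fun j => s.measurableSet_fiber _) fun j k hjk => by
      refine Disjoint.preimage _ (Set.disjoint_singleton.2 fun h => hjk ?_)
      exact R.equivFin.symm.injective (Subtype.ext h)
  have hmeas : ∀ j, Measurable fun ω => N ω (s ⁻¹' {(R.equivFin.symm j : ℝ≥0∞)}) := fun j =>
    (Measure.measurable_coe (s.measurableSet_fiber _)).comp hN.measurable
  rw [hR (fun y => 1 - negExp y) μ (by simp)]
  have hRid : ∀ ω, negExp (∫⁻ x, s x ∂(N ω)) = ∏ j : Fin R.card,
      negExp (R.equivFin.symm j * N ω (s ⁻¹' {(R.equivFin.symm j : ℝ≥0∞)})) := fun ω => by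
    rw [← negExp_sum]
    exact congrArg negExp (hR id (N ω) rfl)
  simp_rw [hRid, negExp_sum]
  have hind' := hind.comp (fun j t => negExp (R.equivFin.symm j * t)) fun j => by fun_prop
  refine (lintegral_prod_eq_prod_lintegral_of_indepFun Finset.univ _ hind' fun j => by
    have := hmeas j
    fun_prop).trans ?_
  refine Finset.prod_congr rfl fun j _ => ?_
  simp only [Function.comp_apply]
  rw [hN.lintegral_negExp_mul (s.measurableSet_fiber _), mul_comm]
  refine (SimpleFunc.finMeasSupp_iff.1 hs _ ?_).ne
  exact (Finset.mem_erase.1 (R.equivFin.symm j).2).1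

/-- The Laplace functional of a Poisson point process. -/
theorem lintegral_negExp [IsProbabilityMeasure P] [SigmaFinite μ]
    (hN : IsPoissonPointProcess P N μ) {u : E → ℝ≥0∞} (hu : Measurable u) :
    ∫⁻ ω, negExp (∫⁻ x, u x ∂(N ω)) ∂P = negExp (∫⁻ x, (1 - negExp (u x)) ∂μ) := by
  -- Cutting off by the spanning sets gives the nonzero level sets finite intensity without changing
  -- the supremum.
  set s : ℕ → SimpleFunc E ℝ≥0∞ := fun n => (SimpleFunc.eapprox u n).restrict (spanningSets μ n)
  have hs_apply : ∀ n x, s n x = (spanningSets μ n).indicator (SimpleFunc.eapprox u n) x :=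
    fun n x => SimpleFunc.restrict_apply _ (measurableSet_spanningSets μ n) x
  have hs_mono : Monotone fun n x => s n x := by
    intro m n hmn x
    simp only [hs_apply]
    refine (Set.indicator_le_indicator_of_subset (monotone_spanningSets μ hmn) (fun _ => zero_le)
      x).trans (Set.indicator_le_indicator ?_)
    exact SimpleFunc.monotone_eapprox u hmn x
  have hs_sup : ∀ x, ⨆ n, s n x = u x := by
    intro x
    refine le_antisymm (iSup_le fun n => ?_) ?_
    · rw [hs_apply]
      refine (Set.indicator_le_self _ _ _).trans ?_
      rw [← SimpleFunc.iSup_eapprox_apply hu x]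
      exact le_iSup (fun n => SimpleFunc.eapprox u n x) n
    · rw [← SimpleFunc.iSup_eapprox_apply hu x]
      refine iSup_le fun n => ?_
      obtain ⟨k, hk⟩ := Set.mem_iUnion.1 ((iUnion_spanningSets μ).symm ▸ Set.mem_univ x)
      refine le_trans ?_ (le_iSup (fun n => s n x) (max n k))
      simp only [hs_apply]
      rw [Set.indicator_of_mem (monotone_spanningSets μ (le_max_right n k) hk)]
      exact SimpleFunc.monotone_eapprox u (le_max_left n k) x
  have hs_fin : ∀ n, (s n).FinMeasSupp μ := fun n => by
    refine SimpleFunc.finMeasSupp_iff_support.2 ((measure_mono ?_).trans_lt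
      (measure_spanningSets_lt_top μ n))
    intro x hx
    by_contra h
    exact hx (by rw [hs_apply, Set.indicator_of_notMem h])
  have hN_meas : ∀ n, Measurable fun ω => ∫⁻ x, s n x ∂(N ω) := fun n =>
    (Measure.measurable_lintegral (s n).measurable).comp hN.measurable
  simp_rw [← hs_sup, lintegral_iSup (fun n => (s n).measurable) hs_mono, negExp_iSup,
    ENNReal.sub_iInf]
  rw [lintegral_iInf (f := fun n ω => negExp (∫⁻ x, s n x ∂(N ω)))
      (fun n => measurable_negExp.comp (hN_meas n))
      (fun m n hmn ω => antitone_negExp (lintegral_mono (hs_mono hmn)))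
      ((lintegral_mono fun ω => negExp_le_one _).trans_lt (by simp)).ne,
    lintegral_iSup (f := fun n x => 1 - negExp (s n x))
      (fun n => measurable_const.sub (measurable_negExp.comp (s n).measurable))
      (fun m n hmn x => tsub_le_tsub_left (antitone_negExp (hs_mono hmn x)) _), negExp_iSup]
  simp_rw [fun n => hN.lintegral_negExp_simpleFunc (s n) (hs_fin n)]

end IsPoissonPointProcess

end

/-! ### Gamma integrals over the plane. -/

noncomputable section

open Real in
lemma lintegral_plane_exp_neg_mul_rpow {η b : ℝ} (hη : 1 ≤ η) (hb : 0 < b) :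
    ∫⁻ x : Plane, ENNReal.ofReal (exp (-b * ‖x‖ ^ η)) =
      ENNReal.ofReal (π * b ^ (-2 / η) * Gamma (2 / η + 1)) := by
  have hmp := Complex.orthonormalBasisOneI.repr.measurePreserving
  have hpos : 0 < π * b ^ (-2 / η) * Gamma (2 / η + 1) := by
    have : 0 < Gamma (2 / η + 1) := Gamma_pos_of_pos (by positivity)
    positivity
  have hint := Complex.integral_exp_neg_mul_rpow hη hb
  rw [← hmp.lintegral_comp (by fun_prop)]
  simp only [LinearIsometryEquiv.norm_map]
  rw [← ofReal_integral_eq_lintegral_ofReal _ (ae_of_all _ fun x => (exp_pos _).le), hint]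
  -- A non-integrable function has Bochner integral 0, so the positive value already found forces
  -- integrability.
  exact Integrable.of_integral_ne_zero (hint ▸ hpos.ne')

open Real in
lemma lintegral_Ioi_rpow_mul_exp {a r : ℝ} (ha : 0 < a) (hr : 0 < r) :
    ∫⁻ t in Set.Ioi (0 : ℝ), ENNReal.ofReal (t ^ (a - 1) * exp (-(r * t))) =
      ENNReal.ofReal ((1 / r) ^ a * Gamma a) := by
  have hint := integral_rpow_mul_exp_neg_mul_Ioi ha hr
  have hpos : 0 < (1 / r) ^ a * Gamma a := by
    have : 0 < Gamma a := Gamma_pos_of_pos ha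
    positivity
  rw [← ofReal_integral_eq_lintegral_ofReal _ _, hint]
  · exact Integrable.of_integral_ne_zero (hint ▸ hpos.ne')
  · exact (ae_restrict_mem measurableSet_Ioi).mono fun t (ht : 0 < t) => by
      simp only [Pi.zero_apply]; positivity

-- Write u^q Γ(q) = ∫ t^(q-1) exp (-t / u) dt and apply Tonelli. The integral over the plane
-- produces (t / c)^(-2/η), leaving a Gamma integral of exponent q - 2/η, positive by `hq`.
open Real in
lemma lintegral_plane_one_div_rpow {η c q : ℝ} (hη : 1 ≤ η) (hc : 0 < c) (hq : 2 / η < q) :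
    ∫⁻ x : Plane, ENNReal.ofReal ((1 / (1 + ‖x‖ ^ η / c)) ^ q * Gamma q) =
      ENNReal.ofReal (π * c ^ (2 / η) * Gamma (2 / η + 1) * Gamma (q - 2 / η)) := by
  have hδ : 0 < 2 / η := by positivity
  have hΓ : 0 < Gamma (2 / η + 1) := Gamma_pos_of_pos (by positivity)
  have hΓ' : 0 < Gamma (q - 2 / η) := Gamma_pos_of_pos (by linarith)
  calc ∫⁻ x : Plane, ENNReal.ofReal ((1 / (1 + ‖x‖ ^ η / c)) ^ q * Gamma q)
      = ∫⁻ x : Plane, ∫⁻ t in Set.Ioi (0 : ℝ),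
          ENNReal.ofReal (t ^ (q - 1) * exp (-((1 + ‖x‖ ^ η / c) * t))) := by
        refine lintegral_congr fun x => ?_
        rw [lintegral_Ioi_rpow_mul_exp (hδ.trans hq) (by positivity)]
    _ = ∫⁻ t in Set.Ioi (0 : ℝ), ∫⁻ x : Plane,
          ENNReal.ofReal (t ^ (q - 1) * exp (-((1 + ‖x‖ ^ η / c) * t))) :=
        lintegral_lintegral_swap (by
          apply Measurable.aemeasurable
          unfold Function.uncurry
          fun_prop)
    _ = ∫⁻ t in Set.Ioi (0 : ℝ), ENNReal.ofReal (π * c ^ (2 / η) * Gamma (2 / η + 1)) *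
          ENNReal.ofReal (t ^ ((q - 2 / η) - 1) * exp (-(1 * t))) := by
        refine setLIntegral_congr_fun measurableSet_Ioi fun t (ht : 0 < t) => ?_
        have h1 : ∀ x : Plane, ENNReal.ofReal (t ^ (q - 1) * exp (-((1 + ‖x‖ ^ η / c) * t))) =
            ENNReal.ofReal (t ^ (q - 1) * exp (-t)) *
              ENNReal.ofReal (exp (-(t / c) * ‖x‖ ^ η)) := fun x => by
          rw [← ENNReal.ofReal_mul (by positivity), mul_assoc, ← exp_add]
          ring_nf
        simp only [h1]
        rw [lintegral_const_mul _ (by fun_prop),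
          lintegral_plane_exp_neg_mul_rpow hη (by positivity),
          ← ENNReal.ofReal_mul (by positivity), ← ENNReal.ofReal_mul (by positivity)]
        congr 1
        rw [neg_div, div_rpow ht.le hc.le, rpow_neg hc.le,
          show q - 2 / η - 1 = (q - 1) + -(2 / η) by ring, rpow_add ht, one_mul]
        field_simp
    _ = _ := by
        rw [lintegral_const_mul _ (by fun_prop),
          lintegral_Ioi_rpow_mul_exp (by linarith) one_pos, ← ENNReal.ofReal_mul (by positivity)]
        simp

open Real in
lemma integrable_plane_one_div_rpow {η c q : ℝ} (hη : 1 ≤ η) (hc : 0 < c) (hq : 2 / η < q) :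
    Integrable fun x : Plane => (1 / (1 + ‖x‖ ^ η / c)) ^ q * Gamma q := by
  have hq0 : 0 < Gamma q := Gamma_pos_of_pos (lt_trans (by positivity) hq)
  refine ⟨Measurable.aestronglyMeasurable (by fun_prop), ?_⟩
  rw [hasFiniteIntegral_iff_ofReal (ae_of_all _ fun x => by simp only [Pi.zero_apply]; positivity),
    lintegral_plane_one_div_rpow hη hc hq]
  exact ENNReal.ofReal_lt_top

open Real in
lemma integral_plane_one_div_rpow {η c q : ℝ} (hη : 1 ≤ η) (hc : 0 < c) (hq : 2 / η < q) :
    ∫ x : Plane, (1 / (1 + ‖x‖ ^ η / c)) ^ q * Gamma q =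
      π * c ^ (2 / η) * Gamma (2 / η + 1) * Gamma (q - 2 / η) := by
  have hδ : 0 < 2 / η := by positivity
  have hΓ : 0 < Gamma (2 / η + 1) := Gamma_pos_of_pos (by positivity)
  have hΓ' : 0 < Gamma (q - 2 / η) := Gamma_pos_of_pos (by linarith)
  have hq0 : 0 < Gamma q := Gamma_pos_of_pos (hδ.trans hq)
  rw [integral_eq_lintegral_of_nonneg_ae
    (ae_of_all _ fun x => by simp only [Pi.zero_apply]; positivity)
    (integrable_plane_one_div_rpow hη hc hq).aestronglyMeasurable,
    lintegral_plane_one_div_rpow hη hc hq, ENNReal.toReal_ofReal (by positivity)]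

/-- The probability of success against an interferer at `x`, active with probability `a`, under
Rayleigh fading. -/
def successProb (η c a : ℝ) (x : Plane) : ℝ := 1 - a * (1 / (1 + ‖x‖ ^ η / c))

lemma successProb_mem {η c a : ℝ} (hc : 0 < c) (ha : a ∈ Set.Icc (0 : ℝ) 1) (x : Plane) :
    successProb η c a x ∈ Set.Icc (0 : ℝ) 1 := by
  have h1 : 1 / (1 + ‖x‖ ^ η / c) ≤ 1 := (div_le_one (by positivity)).2 (by
    have : 0 ≤ ‖x‖ ^ η / c := by positivity
    linarith)
  have h0 : 0 ≤ 1 / (1 + ‖x‖ ^ η / c) := by positivity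
  rw [successProb]
  constructor <;> nlinarith [ha.1, ha.2]

variable {η c : ℝ}

lemma integrable_one_div_plane (hη : 2 < η) (hc : 0 < c) :
    Integrable fun x : Plane => 1 / (1 + ‖x‖ ^ η / c) := by
  simpa using integrable_plane_one_div_rpow (q := 1) (by linarith) hc
    ((div_lt_one (by linarith)).2 hη)

lemma integrable_one_div_plane_sq (hη : 2 < η) (hc : 0 < c) :
    Integrable fun x : Plane => (1 / (1 + ‖x‖ ^ η / c)) ^ 2 := by
  simpa [Real.Gamma_two] using integrable_plane_one_div_rpow (q := 2) (by linarith) hc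
    (((div_lt_one (by linarith)).2 hη).trans one_lt_two)

-- With δ = 2/η, the reflection formula gives Γ(δ + 1) Γ(1 - δ) = πδ / sin (πδ).
open Real in
lemma integral_one_div_plane (hη : 2 < η) (hc : 0 < c) :
    ∫ x : Plane, 1 / (1 + ‖x‖ ^ η / c) = 2 * π ^ 2 * c ^ (2 / η) / (η * sin (2 * π / η)) := by
  have h := integral_plane_one_div_rpow (q := 1) (by linarith) hc
    ((div_lt_one (by linarith)).2 hη)
  simp only [rpow_one, Gamma_one, mul_one] at h
  rw [h, Gamma_add_one (by positivity), mul_assoc, mul_assoc (2 / η), Gamma_mul_Gamma_one_sub,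
    show π * (2 / η) = 2 * π / η by ring]
  field_simp

-- Since Γ(1) = Γ(2) = 1, the ratio to the first-power integral is Γ(2 - δ) / Γ(1 - δ) = 1 - δ, with
-- δ = 2/η.
open Real in
lemma integral_one_div_plane_sq (hη : 2 < η) (hc : 0 < c) :
    ∫ x : Plane, (1 / (1 + ‖x‖ ^ η / c)) ^ 2 =
      2 * π ^ 2 * c ^ (2 / η) / (η * sin (2 * π / η)) * (1 - 2 / η) := by
  have hδ : 2 / η < 1 := (div_lt_one (by linarith)).2 hη
  have h := integral_plane_one_div_rpow (q := 2) (by linarith) hc (hδ.trans one_lt_two)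
  have h1 := integral_plane_one_div_rpow (q := 1) (by linarith) hc hδ
  simp only [rpow_one, Gamma_one, mul_one, integral_one_div_plane hη hc] at h1
  simp only [rpow_two, Gamma_two, mul_one] at h
  rw [h, h1, show 2 - 2 / η = (1 - 2 / η) + 1 by ring,
    Gamma_add_one (s := 1 - 2 / η) (by linarith)]
  ring

lemma integrable_one_sub_successProb (hη : 2 < η) (hc : 0 < c) (a : ℝ) :
    Integrable fun x => 1 - successProb η c a x := by
  simpa [successProb] using (integrable_one_div_plane hη hc).const_mul a

lemma one_sub_successProb_sq (a : ℝ) (x : Plane) :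
    1 - successProb η c a x ^ 2 =
      2 * a * (1 / (1 + ‖x‖ ^ η / c)) - a ^ 2 * (1 / (1 + ‖x‖ ^ η / c)) ^ 2 := by
  rw [successProb]
  ring

lemma integrable_one_sub_successProb_sq (hη : 2 < η) (hc : 0 < c) (a : ℝ) :
    Integrable fun x => 1 - successProb η c a x ^ 2 := by
  simp_rw [one_sub_successProb_sq]
  exact ((integrable_one_div_plane hη hc).const_mul _).sub
    ((integrable_one_div_plane_sq hη hc).const_mul _)

lemma integral_one_sub_successProb (hη : 2 < η) (hc : 0 < c) (a : ℝ) :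
    ∫ x, (1 - successProb η c a x) =
      2 * Real.pi ^ 2 * c ^ (2 / η) / (η * Real.sin (2 * Real.pi / η)) * a := by
  simp only [successProb, sub_sub_cancel]
  rw [integral_const_mul, integral_one_div_plane hη hc, mul_comm]

lemma integral_one_sub_successProb_sq (hη : 2 < η) (hc : 0 < c) (a : ℝ) :
    ∫ x, (1 - successProb η c a x ^ 2) =
      2 * Real.pi ^ 2 * c ^ (2 / η) / (η * Real.sin (2 * Real.pi / η)) *
        (a * (2 - a * (1 - 2 / η))) := by
  simp_rw [one_sub_successProb_sq]
  rw [integral_sub ((integrable_one_div_plane hη hc).const_mul _)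
    ((integrable_one_div_plane_sq hη hc).const_mul _), integral_const_mul, integral_const_mul,
    integral_one_div_plane hη hc, integral_one_div_plane_sq hη hc]
  ring

end

/-! ### Averaging over activities and interfering gains. -/

noncomputable section

namespace InterferenceField

variable {V : ℕ}

open Classical in
/-- The interference, scaled by `κ`, caused by a device at `x` whose type, activity and gain
are given by `z`. -/
def deviceTerm (κ : ℝ≥0∞) (η : ℝ) (p : Fin V → ℝ) (x₀ x : Plane) (z : Fin V × Bool × ℝ) : ℝ≥0∞ :=
  if x ≠ x₀ ∧ z.2.1 = true then
    κ * ENNReal.ofReal (p z.1) * ‖x‖ₑ ^ (-η) * ENNReal.ofReal z.2.2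
  else 0

open Classical in
/-- The expectation of the exponential of minus the scaled interference caused by a device at `x`
of type `v`. -/
def deviceFactor (κ : ℝ≥0∞) (η : ℝ) (p α : Fin V → ℝ) (x₀ x : Plane) (v : Fin V) : ℝ≥0∞ :=
  if x ≠ x₀ then
    ENNReal.ofReal (α v) *
      ∫⁻ h, negExp (κ * ENNReal.ofReal (p v) * ‖x‖ₑ ^ (-η) * ENNReal.ofReal h) ∂(expMeasure 1) +
    ENNReal.ofReal (1 - α v)
  else 1

lemma measurable_deviceTerm (κ : ℝ≥0∞) (η : ℝ) (p : Fin V → ℝ) (x₀ : Plane) :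
    Measurable fun q : Plane × Fin V × Bool × ℝ => deviceTerm κ η p x₀ q.1 q.2 := by
  have hp : Measurable fun q : Plane × Fin V × Bool × ℝ => p q.2.1 :=
    (measurable_of_finite p).comp (by fun_prop)
  refine Measurable.ite ?_ (by fun_prop) measurable_const
  refine MeasurableSet.inter ?_ ?_
  · exact (measurableSet_singleton x₀).compl.preimage measurable_fst
  · exact (measurableSet_singleton true).preimage (by fun_prop :
      Measurable fun q : Plane × Fin V × Bool × ℝ => q.2.2.1)

lemma measurable_deviceFactor (κ : ℝ≥0∞) (η : ℝ) (p α : Fin V → ℝ) (x₀ : Plane) :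
    Measurable fun q : Plane × Fin V => deviceFactor κ η p α x₀ q.1 q.2 := by
  have := isProbabilityMeasure_expMeasure one_pos
  have hp : Measurable p := measurable_of_finite p
  have hα : Measurable α := measurable_of_finite α
  refine Measurable.ite ((measurableSet_singleton x₀).compl.preimage measurable_fst) ?_
    measurable_const
  have : Measurable fun q : Plane × Fin V =>
      ∫⁻ h, negExp (κ * ENNReal.ofReal (p q.2) * ‖q.1‖ₑ ^ (-η) * ENNReal.ofReal h)
        ∂(expMeasure 1) :=
    Measurable.lintegral_prod_right' (f := fun r : (Plane × Fin V) × ℝ =>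
      negExp (κ * ENNReal.ofReal (p r.1.2) * ‖r.1.1‖ₑ ^ (-η) * ENNReal.ofReal r.2)) (by fun_prop)
  fun_prop

lemma deviceFactor_le_one (κ : ℝ≥0∞) (η : ℝ) (p : Fin V → ℝ) {α : Fin V → ℝ}
    (hα : ∀ v, α v ∈ Set.Icc (0 : ℝ) 1) (x₀ x : Plane) (v : Fin V) :
    deviceFactor κ η p α x₀ x v ≤ 1 := by
  have := isProbabilityMeasure_expMeasure one_pos
  rw [deviceFactor]
  split_ifs
  · refine (add_le_add_left (mul_le_of_le_one_right' ?_) _).trans_eq ?_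
    · exact (lintegral_mono fun h => negExp_le_one _).trans_eq (by simp)
    · rw [← ENNReal.ofReal_add (hα v).1 (sub_nonneg.2 (hα v).2)]
      simp
  · exact le_rfl

/-- Each device has exactly one type, so the double sum over types and devices collapses to a sum
over devices. -/
lemma mul_interference_eq {Ω : Type*} (F : InterferenceField Ω V) (κ : ℝ≥0∞) (η : ℝ)
    (p : Fin V → ℝ) (x₀ : Plane) (ω : Ω) :
    κ * F.interference η p x₀ ω =
      ∑' i, deviceTerm κ η p x₀ (F.loc i ω) (F.type i ω, F.active i ω, F.gain i ω) := by
  rw [interference, ← Summable.tsum_finsetSum (fun _ _ => ENNReal.summable),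
    ← ENNReal.tsum_mul_left]
  congr with i
  rw [Finset.sum_eq_single (F.type i ω) (fun v _ hv => if_neg fun h => hv h.1.symm) (by simp),
    deviceTerm]
  simp only [true_and, mul_ite, mul_zero]
  congr 1
  ring

variable {Ω : Type*} [MeasurableSpace Ω] {F : InterferenceField Ω V} {P : Measure Ω} {lam : ℝ}
  {f α p : Fin V → ℝ} {η : ℝ} {x₀ : Plane} {κ : ℝ≥0∞}

namespace IsPoissonRayleigh

variable (hF : F.IsPoissonRayleigh P lam f α)
include hF

lemma measurable_mark (i : ℕ) :
    Measurable fun ω => (F.type i ω, F.active i ω, F.gain i ω) :=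
  (hF.measurable_type i).prodMk ((hF.measurable_active i).prodMk (hF.measurable_gain i))

lemma measurable_locs : Measurable fun ω i => F.loc i ω := measurable_pi_lambda _ hF.measurable_loc

lemma measurable_types : Measurable fun ω i => F.type i ω :=
  measurable_pi_lambda _ hF.measurable_type

lemma measurable_marks :
    Measurable fun ω i => (F.type i ω, F.active i ω, F.gain i ω) :=
  measurable_pi_lambda _ hF.measurable_mark

lemma map_marks : P.map (fun ω i => (F.type i ω, F.active i ω, F.gain i ω)) =
    Measure.infinitePi fun i => P.map fun ω => (F.type i ω, F.active i ω, F.gain i ω) :=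
  hF.iIndep_marks.map_fun_eq_infinitePi_map hF.measurable_mark

variable [IsProbabilityMeasure P]

/-- Inactive devices are obtained by subtracting the active ones from the law of the type. Joint
probabilities avoid conditioning on a type of probability 0. -/
lemma measure_type_active (hf : ∀ v, 0 ≤ f v)
    (i : ℕ) (v : Fin V) (b : Bool) :
    P.map (fun ω => (F.type i ω, F.active i ω)) {(v, b)} =
      ENNReal.ofReal (f v) * ENNReal.ofReal (if b then α v else 1 - α v) := by
  have hm := (hF.measurable_type i).prodMk (hF.measurable_active i)
  have hset : ∀ b : Bool, (fun ω => (F.type i ω, F.active i ω)) ⁻¹' {(v, b)} =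
      {ω | F.type i ω = v ∧ F.active i ω = b} := fun b => by
    ext ω; simp
  have htrue := hF.law_active i v
  have hmt : MeasurableSet {ω | F.type i ω = v ∧ F.active i ω = true} :=
    hset true ▸ hm (measurableSet_singleton _)
  rw [Measure.map_apply hm (measurableSet_singleton _), hset, ← ofReal_measureReal,
    ← ENNReal.ofReal_mul (hf v)]
  congr 1
  cases b with
  | true => simpa using htrue
  | false =>
    have hunion := measureReal_sdiff_add_inter (μ := P) (s := {ω | F.type i ω = v}) hmt
    have h1 : {ω | F.type i ω = v} \ {ω | F.type i ω = v ∧ F.active i ω = true} =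
        {ω | F.type i ω = v ∧ F.active i ω = false} := by
      ext ω; simp +contextual
    have h2 : {ω | F.type i ω = v} ∩ {ω | F.type i ω = v ∧ F.active i ω = true} =
        {ω | F.type i ω = v ∧ F.active i ω = true} := by
      ext ω; simp +contextual
    rw [h1, h2, htrue, hF.law_type i v] at hunion
    simp only [Bool.false_eq_true, if_false]
    linarith

lemma lintegral_mark (hf : ∀ v, 0 ≤ f v) (i : ℕ)
    {φ : Fin V × Bool × ℝ → ℝ≥0∞} (hφ : Measurable φ) :
    ∫⁻ z, φ z ∂(P.map fun ω => (F.type i ω, F.active i ω, F.gain i ω)) =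
      ∑ v, ENNReal.ofReal (f v) *
        (ENNReal.ofReal (α v) * ∫⁻ h, φ (v, true, h) ∂(expMeasure 1) +
          ENNReal.ofReal (1 - α v) * ∫⁻ h, φ (v, false, h) ∂(expMeasure 1)) := by
  rw [lintegral_map hφ (hF.measurable_mark i)]
  have h := lintegral_comp_prodMk_of_indepFun
    ((hF.measurable_type i).prodMk (hF.measurable_active i)) (hF.measurable_gain i)
    (hF.indep_gain i).symm (g := fun q => φ (q.1.1, q.1.2, q.2)) (by fun_prop)
  rw [h, hF.law_gain i, lintegral_fintype, Fintype.sum_prod_type]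
  refine Finset.sum_congr rfl fun v _ => ?_
  simp only [Fintype.sum_bool, hF.measure_type_active hf]
  simp only [if_true, Bool.false_eq_true, if_false]
  ring

/-- This identifies `deviceFactor` as the conditional expectation given the type for one device, in
the form that `setLIntegral_infProd_infinitePi` requires. -/
lemma setLIntegral_negExp_deviceTerm (hf : ∀ v, 0 ≤ f v) (hα : ∀ v, α v ∈ Set.Icc (0 : ℝ) 1)
    (κ : ℝ≥0∞) (η : ℝ) (p : Fin V → ℝ) (x₀ x : Plane) (i : ℕ) {C : Set (Fin V)}
    (hC : MeasurableSet C) :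
    ∫⁻ z in Prod.fst ⁻¹' C, negExp (deviceTerm κ η p x₀ x z)
        ∂(P.map fun ω => (F.type i ω, F.active i ω, F.gain i ω)) =
      ∫⁻ z in Prod.fst ⁻¹' C, deviceFactor κ η p α x₀ x z.1
        ∂(P.map fun ω => (F.type i ω, F.active i ω, F.gain i ω)) := by
  have := isProbabilityMeasure_expMeasure one_pos
  have hC' : MeasurableSet (Prod.fst ⁻¹' C : Set (Fin V × Bool × ℝ)) := hC.preimage measurable_fst
  have h1 : Measurable fun z => negExp (deviceTerm κ η p x₀ x z) :=
    measurable_negExp.comp ((measurable_deviceTerm κ η p x₀).comp measurable_prodMk_left)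
  have h2 : Measurable fun z : Fin V × Bool × ℝ => deviceFactor κ η p α x₀ x z.1 :=
    (measurable_of_finite (deviceFactor κ η p α x₀ x)).comp measurable_fst
  rw [← lintegral_indicator hC', ← lintegral_indicator hC',
    hF.lintegral_mark hf i (h1.indicator hC'), hF.lintegral_mark hf i (h2.indicator hC')]
  refine Finset.sum_congr rfl fun v _ => ?_
  congr 1
  by_cases hv : v ∈ C
  · simp only [Set.indicator, Set.mem_preimage, hv, if_true, lintegral_const, measure_univ,
      mul_one]
    have hsum : ENNReal.ofReal (α v) + ENNReal.ofReal (1 - α v) = 1 := by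
      rw [← ENNReal.ofReal_add (hα v).1 (sub_nonneg.2 (hα v).2)]
      simp
    rw [← add_mul, hsum, one_mul]
    by_cases hx : x = x₀
    · simp [deviceTerm, deviceFactor, hx, hsum]
    · simp [deviceTerm, deviceFactor, hx]
  · simp [Set.indicator, hv]

lemma isProbabilityMeasure_mark (i : ℕ) :
    IsProbabilityMeasure (P.map fun ω => (F.type i ω, F.active i ω, F.gain i ω)) :=
  Measure.isProbabilityMeasure_map (hF.measurable_mark i).aemeasurable

/-- Averaging over the activities and gains, given the locations and types. -/
lemma setLIntegral_negExp_tsum (hf : ∀ v, 0 ≤ f v) (hα : ∀ v, α v ∈ Set.Icc (0 : ℝ) 1)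
    (κ : ℝ≥0∞) (η : ℝ) (p : Fin V → ℝ) (x₀ : Plane)
    {S : Set ((ℕ → Plane) × (ℕ → Fin V))} (hS : MeasurableSet S) :
    ∫⁻ ω in (fun ω => ((fun i => F.loc i ω), fun i => F.type i ω)) ⁻¹' S,
        negExp (κ * F.interference η p x₀ ω) ∂P =
      ∫⁻ ω in (fun ω => ((fun i => F.loc i ω), fun i => F.type i ω)) ⁻¹' S,
        infProd (fun i => deviceFactor κ η p α x₀ (F.loc i ω) (F.type i ω)) ∂P := by
  have := hF.isProbabilityMeasure_mark
  have hmD := (hF.measurable_locs.prodMk hF.measurable_types) hS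
  have hτ : Measurable fun q : (ℕ → Plane) × (ℕ → Fin V × Bool × ℝ) =>
      (q.1, fun i => (q.2 i).1) := by fun_prop
  have hT := measurable_deviceTerm κ η p x₀
  have hG := measurable_deviceFactor κ η p α x₀
  have h1 : Measurable fun q : (ℕ → Plane) × (ℕ → Fin V × Bool × ℝ) =>
      infProd fun i => negExp (deviceTerm κ η p x₀ (q.1 i) (q.2 i)) :=
    Measurable.infProd fun i => measurable_negExp.comp
      (hT.comp (by fun_prop : Measurable fun q : (ℕ → Plane) × (ℕ → Fin V × Bool × ℝ) =>
        (q.1 i, q.2 i)))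
  have h2 : Measurable fun q : (ℕ → Plane) × (ℕ → Fin V × Bool × ℝ) =>
      infProd fun i => deviceFactor κ η p α x₀ (q.1 i) (q.2 i).1 :=
    Measurable.infProd fun i =>
      hG.comp (by fun_prop : Measurable fun q : (ℕ → Plane) × (ℕ → Fin V × Bool × ℝ) =>
        (q.1 i, (q.2 i).1))
  have e1 := lintegral_comp_prodMk_of_indepFun hF.measurable_locs hF.measurable_marks hF.indep_loc
    (h1.indicator (hτ hS))
  have e2 := lintegral_comp_prodMk_of_indepFun hF.measurable_locs hF.measurable_marks hF.indep_loc
    (h2.indicator (hτ hS))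
  rw [← lintegral_indicator hmD, ← lintegral_indicator hmD]
  simp_rw [mul_interference_eq, negExp_tsum]
  refine Eq.trans e1 (Eq.trans ?_ e2.symm)
  -- Locations are independent of the marks, so they can be frozen; the event then becomes the slice
  -- of `S` at `x`, an event about types alone.
  rw [hF.map_marks]
  refine lintegral_congr fun x => ?_
  have hSx : MeasurableSet (Prod.mk x ⁻¹' S) := measurable_prodMk_left hS
  have key := setLIntegral_infProd_infinitePi
    (fun i => P.map fun ω => (F.type i ω, F.active i ω, F.gain i ω))
    (τ := Prod.fst) measurable_fst
    (Y := fun i z => negExp (deviceTerm κ η p x₀ (x i) z))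
    (fun i => measurable_negExp.comp (hT.comp measurable_prodMk_left))
    (fun i z => negExp_le_one _)
    (G := fun i v => deviceFactor κ η p α x₀ (x i) v)
    (fun i => hG.comp measurable_prodMk_left)
    (fun i v => deviceFactor_le_one κ η p hα x₀ (x i) v)
    (fun i C hC => hF.setLIntegral_negExp_deviceTerm hf hα κ η p x₀ (x i) i hC) hSx
  have hτ' : Measurable fun (z : ℕ → Fin V × Bool × ℝ) i => (z i).1 := by fun_prop
  rw [← lintegral_indicator (hτ' hSx), ← lintegral_indicator (hτ' hSx)] at key
  exact key

end IsPoissonRayleigh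
end InterferenceField
end

/-! ### The conditional success probability as a product, and the moments of that product. -/

noncomputable section

namespace InterferenceField

variable {V : ℕ} {Ω : Type*} [MeasurableSpace Ω] {F : InterferenceField Ω V} {P : Measure Ω}
  {lam : ℝ} {f α p : Fin V → ℝ} {η : ℝ} {x₀ : Plane} {κ : ℝ≥0∞}

/-- The product depends on the devices only through their counting measure, not their numbering;
hence it is measurable for the conditioning σ-algebra. -/
lemma infProd_deviceFactor_eq {Ω : Type*} (F : InterferenceField Ω V)
    {α : Fin V → ℝ} (hα : ∀ v, α v ∈ Set.Icc (0 : ℝ) 1) (κ : ℝ≥0∞)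
    (η : ℝ) (p : Fin V → ℝ) (x₀ : Plane) (ω : Ω) :
    infProd (fun i => deviceFactor κ η p α x₀ (F.loc i ω) (F.type i ω)) =
      negExp (∫⁻ y, negLog (deviceFactor κ η p α x₀ y.1 y.2) ∂(F.markedCounting ω)) := by
  have hu : Measurable fun y : Plane × Fin V => negLog (deviceFactor κ η p α x₀ y.1 y.2) :=
    measurable_negLog.comp (measurable_deviceFactor κ η p α x₀)
  rw [infProd_eq_negExp fun i => deviceFactor_le_one κ η p hα x₀ _ _, markedCounting,
    lintegral_sum_measure]
  congr 2 with i
  rw [lintegral_dirac' _ hu]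

/-- The marked counting measure of a sequence of locations and a sequence of types. -/
def seqCounting (q : (ℕ → Plane) × (ℕ → Fin V)) : Measure (Plane × Fin V) :=
  Measure.sum fun i => Measure.dirac (q.1 i, q.2 i)

lemma measurable_seqCounting : Measurable (seqCounting (V := V)) := by
  refine Measure.measurable_of_measurable_coe _ fun s hs => ?_
  simp_rw [seqCounting, Measure.sum_apply _ hs]
  exact Measurable.tsum fun i => (Measure.measurable_coe hs).comp
    (Measure.measurable_dirac.comp (by fun_prop))

lemma markedCounting_eq {Ω : Type*} (F : InterferenceField Ω V) : F.markedCounting =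
    seqCounting ∘ fun ω => ((fun i => F.loc i ω), fun i => F.type i ω) := rfl

namespace IsPoissonRayleigh

variable (hF : F.IsPoissonRayleigh P lam f α)
include hF

lemma measurable_interference (η : ℝ) (p : Fin V → ℝ) (x₀ : Plane) :
    Measurable (F.interference η p x₀) := by
  have h : F.interference η p x₀ = fun ω => ∑' i, deviceTerm 1 η p x₀ (F.loc i ω)
      (F.type i ω, F.active i ω, F.gain i ω) := by
    ext ω
    rw [← mul_interference_eq, one_mul]
  rw [h]
  exact Measurable.tsum fun i => (measurable_deviceTerm 1 η p x₀).comp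
    ((hF.measurable_loc i).prodMk (hF.measurable_mark i))

lemma measurable_sir (η : ℝ) (p : Fin V → ℝ) (p₀ : ℝ) (x₀ : Plane) :
    Measurable (F.sir η p p₀ x₀) := by
  have := hF.measurable_gain₀
  have := hF.measurable_interference η p x₀
  unfold sir
  fun_prop

/-- The interference may be 0 or `∞`; clearing the denominator is still legitimate because the
numerator is finite and, as the intended gain is almost surely positive, nonzero. -/
lemma ae_le_sir_iff {p₀ θ : ℝ} (hp₀ : 0 < p₀) (hx₀ : x₀ ≠ 0) (η : ℝ) (p : Fin V → ℝ) :
    ∀ᵐ ω ∂P, ENNReal.ofReal θ ≤ F.sir η p p₀ x₀ ω ↔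
      ENNReal.ofReal θ / (ENNReal.ofReal p₀ * ‖x₀‖ₑ ^ (-η)) * F.interference η p x₀ ω ≤
        ENNReal.ofReal (F.gain₀ ω) := by
  have h : ∀ᵐ ω ∂P, 0 < F.gain₀ ω := by
    refine ae_of_ae_map (p := fun h : ℝ => 0 < h) hF.measurable_gain₀.aemeasurable ?_
    rw [hF.law_gain₀]
    exact ae_pos_expMeasure_one
  filter_upwards [h] with ω hω
  have hx0 : ‖x₀‖ₑ ≠ 0 := by simpa using hx₀
  set c := ENNReal.ofReal p₀ * ‖x₀‖ₑ ^ (-η) with hc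
  have hc0 : c ≠ 0 := mul_ne_zero (by simpa using hp₀)
    (ENNReal.rpow_pos (pos_iff_ne_zero.2 hx0) enorm_ne_top).ne'
  have hct : c ≠ ∞ := ENNReal.mul_ne_top ENNReal.ofReal_ne_top
    (ENNReal.rpow_ne_top_of_ne_zero hx0 enorm_ne_top)
  have hH0 : ENNReal.ofReal (F.gain₀ ω) ≠ 0 := by simpa using hω
  rw [sir, show ENNReal.ofReal p₀ * ENNReal.ofReal (F.gain₀ ω) * ‖x₀‖ₑ ^ (-η) =
    ENNReal.ofReal (F.gain₀ ω) * c by rw [hc]; ring,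
    ENNReal.le_div_iff_mul_le (Or.inr (mul_ne_zero hH0 hc0))
      (Or.inr (ENNReal.mul_ne_top ENNReal.ofReal_ne_top hct)),
    ← ENNReal.mul_div_right_comm, ENNReal.div_le_iff hc0 hct]

variable [IsProbabilityMeasure P]

/-- Averaging over the gain of the intended link. -/
lemma measure_inter_le_gain₀ (κ : ℝ≥0∞) (η : ℝ) (p : Fin V → ℝ) (x₀ : Plane)
    {S : Set ((ℕ → Plane) × (ℕ → Fin V))} (hS : MeasurableSet S) :
    P ((fun ω => ((fun i => F.loc i ω), fun i => F.type i ω)) ⁻¹' S ∩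
        {ω | κ * F.interference η p x₀ ω ≤ ENNReal.ofReal (F.gain₀ ω)}) =
      ∫⁻ ω in (fun ω => ((fun i => F.loc i ω), fun i => F.type i ω)) ⁻¹' S,
        negExp (κ * F.interference η p x₀ ω) ∂P := by
  have hmD := (hF.measurable_locs.prodMk hF.measurable_types) hS
  have hW : Measurable fun ω i => (F.loc i ω, F.type i ω, F.active i ω, F.gain i ω) :=
    measurable_pi_lambda _ fun i => (hF.measurable_loc i).prodMk (hF.measurable_mark i)
  have hJ : Measurable fun w : ℕ → Plane × Fin V × Bool × ℝ =>
      ∑' i, deviceTerm κ η p x₀ (w i).1 (w i).2 :=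
    Measurable.tsum fun i => (measurable_deviceTerm κ η p x₀).comp (measurable_pi_apply i)
  have hS' : MeasurableSet
      ((fun w : ℕ → Plane × Fin V × Bool × ℝ => ((fun i => (w i).1), fun i => (w i).2.1)) ⁻¹' S) :=
    hS.preimage (by fun_prop)
  have hQ : MeasurableSet {q : (ℕ → Plane × Fin V × Bool × ℝ) × ℝ |
      ∑' i, deviceTerm κ η p x₀ (q.1 i).1 (q.1 i).2 ≤ ENNReal.ofReal q.2} :=
    measurableSet_le (hJ.comp measurable_fst) (by fun_prop)
  have hQ' := (hS'.preimage (measurable_fst (β := ℝ))).inter hQ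
  -- The intended gain is integrated out first, everything else being frozen; its exponential tail
  -- yields `negExp`.
  have e := lintegral_comp_prodMk_of_indepFun hW hF.measurable_gain₀ hF.indep_gain₀.symm
    (measurable_one.indicator hQ' (f := fun _ => (1 : ℝ≥0∞)))
  rw [hF.law_gain₀] at e
  have hI := hF.measurable_interference η p x₀
  rw [← lintegral_indicator_one (hmD.inter (measurableSet_le (by fun_prop)
    hF.measurable_gain₀.ennreal_ofReal)), ← lintegral_indicator hmD]
  simp_rw [mul_interference_eq]
  have hneg : Measurable fun w : ℕ → Plane × Fin V × Bool × ℝ =>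
      negExp (∑' i, deviceTerm κ η p x₀ (w i).1 (w i).2) := measurable_negExp.comp hJ
  have e' := lintegral_map (μ := P) (hneg.indicator hS') hW
  refine e.trans (Eq.trans ?_ e')
  refine lintegral_congr fun w => ?_
  by_cases hw : ((fun i => (w i).1), fun i => (w i).2.1) ∈ S
  · rw [Set.indicator_of_mem (show w ∈ (fun w : ℕ → Plane × Fin V × Bool × ℝ =>
      ((fun i => (w i).1), fun i => (w i).2.1)) ⁻¹' S from hw), ← expMeasure_one_tail,
      ← lintegral_indicator_one (measurableSet_le measurable_const (by fun_prop))]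
    refine lintegral_congr fun y => ?_
    set B := {h : ℝ | ∑' i, deviceTerm κ η p x₀ (w i).1 (w i).2 ≤ ENNReal.ofReal h}
    by_cases hy : y ∈ B
    · rw [Set.indicator_of_mem hy, Set.indicator_of_mem]
      · rfl
      · exact ⟨hw, hy⟩
    · rw [Set.indicator_of_notMem hy, Set.indicator_of_notMem]
      exact fun h => hy h.2
  · rw [Set.indicator_of_notMem (show w ∉ (fun w : ℕ → Plane × Fin V × Bool × ℝ =>
      ((fun i => (w i).1), fun i => (w i).2.1)) ⁻¹' S from hw)]
    exact (lintegral_congr fun y => Set.indicator_of_notMem (fun h => hw h.1) _).trans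
      lintegral_zero

/-- The fragment success delivery probability is a product over the interfering devices. -/
theorem fsdProb_ae_eq (hf : ∀ v, 0 ≤ f v) (hα : ∀ v, α v ∈ Set.Icc (0 : ℝ) 1)
    {p₀ θ : ℝ} (hp₀ : 0 < p₀) (hx₀ : x₀ ≠ 0) (η : ℝ) (p : Fin V → ℝ) :
    F.fsdProb P η p p₀ x₀ θ =ᵐ[P] fun ω => (infProd fun i =>
      deviceFactor (ENNReal.ofReal θ / (ENNReal.ofReal p₀ * ‖x₀‖ₑ ^ (-η))) η p α x₀
        (F.loc i ω) (F.type i ω)).toReal := by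
  have hiff := hF.ae_le_sir_iff hp₀ hx₀ η p (θ := θ)
  generalize ENNReal.ofReal θ / (ENNReal.ofReal p₀ * ‖x₀‖ₑ ^ (-η)) = κ at hiff ⊢
  have hG := measurable_deviceFactor κ η p α x₀
  have hXT := hF.measurable_locs.prodMk hF.measurable_types
  have hM : Measurable F.markedCounting := by
    rw [markedCounting_eq]
    exact measurable_seqCounting.comp hXT
  have hE : MeasurableSet {ω | ENNReal.ofReal θ ≤ F.sir η p p₀ x₀ ω} :=
    measurableSet_le measurable_const (hF.measurable_sir η p p₀ x₀)
  have hprod_meas : Measurable[MeasurableSpace.comap F.markedCounting inferInstance] fun ω =>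
      (infProd fun i => deviceFactor κ η p α x₀ (F.loc i ω) (F.type i ω)).toReal := by
    simp_rw [infProd_deviceFactor_eq F hα]
    exact ((measurable_negExp.comp (Measure.measurable_lintegral (measurable_negLog.comp hG))
      ).ennreal_toReal).comp (comap_measurable F.markedCounting)
  have hint : Integrable (fun ω =>
      (infProd fun i => deviceFactor κ η p α x₀ (F.loc i ω) (F.type i ω)).toReal) P := by
    refine Integrable.of_bound (hprod_meas.mono hM.comap_le le_rfl).aestronglyMeasurable 1
      (ae_of_all _ fun ω => ?_)
    rw [Real.norm_of_nonneg ENNReal.toReal_nonneg]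
    exact ENNReal.toReal_le_of_le_ofReal zero_le_one (by simpa using infProd_le_one _)
  symm
  refine ae_eq_condExp_of_forall_setIntegral_eq hM.comap_le
    ((integrable_const (1 : ℝ)).indicator hE) (fun _ _ _ => hint.integrableOn) ?_
    hprod_meas.stronglyMeasurable.aestronglyMeasurable
  rintro _ ⟨D, hD, rfl⟩ -
  -- An event of the marked counting measure is in particular an event of the sequences of locations
  -- and types, to which the two averaging lemmas apply.
  have hS : MeasurableSet (seqCounting ⁻¹' D) := measurable_seqCounting hD
  have hms : MeasurableSet (F.markedCounting ⁻¹' D) := hM hD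
  have h1 := hF.measure_inter_le_gain₀ κ η p x₀ hS
  rw [hF.setLIntegral_negExp_tsum hf hα κ η p x₀ hS] at h1
  rw [← Set.preimage_comp, ← markedCounting_eq] at h1
  have h2 : P (F.markedCounting ⁻¹' D ∩ {ω | ENNReal.ofReal θ ≤ F.sir η p p₀ x₀ ω}) =
      ∫⁻ ω in F.markedCounting ⁻¹' D,
        infProd (fun i => deviceFactor κ η p α x₀ (F.loc i ω) (F.type i ω)) ∂P := by
    refine Eq.trans (measure_congr ?_) h1
    filter_upwards [hiff] with ω hω
    exact congrArg (ω ∈ F.markedCounting ⁻¹' D ∧ ·) (propext hω)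
  rw [setIntegral_indicator hE, setIntegral_const, smul_eq_mul, mul_one, measureReal_def, h2,
    integral_toReal]
  · exact (Measurable.infProd fun i => hG.comp ((hF.measurable_loc i).prodMk
      (hF.measurable_type i))).aemeasurable
  · exact ae_of_all _ fun ω => (infProd_le_one _).trans_lt ENNReal.one_lt_top

/-- Apply the Laplace functional to u = -log g, for which 1 - exp (-u) = 1 - g. -/
lemma lintegral_infProd_loc {g : Plane → ℝ≥0∞} (hg : Measurable g) (hg1 : ∀ x, g x ≤ 1) :
    ∫⁻ ω, infProd (fun i => g (F.loc i ω)) ∂P =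
      negExp (∫⁻ x, (1 - g x) ∂(ENNReal.ofReal lam • (volume : Measure Plane))) := by
  have hu : Measurable fun x => negLog (g x) := measurable_negLog.comp hg
  have hN : ∀ ω, infProd (fun i => g (F.loc i ω)) =
      negExp (∫⁻ x, negLog (g x) ∂(F.locCounting ω)) := fun ω => by
    rw [infProd_eq_negExp fun i => hg1 _, locCounting, lintegral_sum_measure]
    congr 2 with i
    rw [lintegral_dirac' _ hu]
  have : SigmaFinite (ENNReal.ofReal lam • (volume : Measure Plane)) :=
    SMul.sigmaFinite (μ := (volume : Measure Plane)) lam.toNNReal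
  have h := hF.poisson.lintegral_negExp hu
  simp_rw [negExp_negLog (hg1 _)] at h
  rw [← h]
  exact lintegral_congr hN

omit hF [IsProbabilityMeasure P] in
lemma measurable_deviceFactor_mark_pow (κ : ℝ≥0∞) (η : ℝ) (p α : Fin V → ℝ) (x₀ x : Plane)
    (k : ℕ) :
    Measurable fun z : Fin V × Bool × ℝ => deviceFactor κ η p α x₀ x z.1 ^ k :=
  ((measurable_of_finite (deviceFactor κ η p α x₀ x)).comp measurable_fst).pow_const k

lemma lintegral_deviceFactor_pow (hf : ∀ v, 0 ≤ f v)
    (hα : ∀ v, α v ∈ Set.Icc (0 : ℝ) 1) (κ : ℝ≥0∞) (η : ℝ) (p : Fin V → ℝ) (x₀ x : Plane)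
    (k i : ℕ) :
    ∫⁻ z, deviceFactor κ η p α x₀ x z.1 ^ k
      ∂(P.map fun ω => (F.type i ω, F.active i ω, F.gain i ω)) =
      ∑ v, ENNReal.ofReal (f v) * deviceFactor κ η p α x₀ x v ^ k := by
  have := isProbabilityMeasure_expMeasure one_pos
  rw [hF.lintegral_mark hf i (measurable_deviceFactor_mark_pow κ η p α x₀ x k)]
  refine Finset.sum_congr rfl fun v _ => ?_
  simp only [lintegral_const, measure_univ, mul_one]
  rw [← add_mul,
    ← ENNReal.ofReal_add (hα v).1 (sub_nonneg.2 (hα v).2)]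
  simp

/-- The moments of the product over the interfering devices, with the types averaged out. -/
lemma lintegral_infProd_deviceFactor_pow (hf : ∀ v, 0 ≤ f v) (hf_sum : ∑ v, f v = 1)
    (hα : ∀ v, α v ∈ Set.Icc (0 : ℝ) 1) (κ : ℝ≥0∞) (η : ℝ) (p : Fin V → ℝ) (x₀ : Plane) (k : ℕ) :
    ∫⁻ ω, infProd (fun i => deviceFactor κ η p α x₀ (F.loc i ω) (F.type i ω)) ^ k ∂P =
      negExp (∫⁻ x, (1 - ∑ v, ENNReal.ofReal (f v) * deviceFactor κ η p α x₀ x v ^ k)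
        ∂(ENNReal.ofReal lam • (volume : Measure Plane))) := by
  have := hF.isProbabilityMeasure_mark
  have hG := measurable_deviceFactor κ η p α x₀
  have hG1 : ∀ x v, deviceFactor κ η p α x₀ x v ^ k ≤ 1 := fun x v =>
    pow_le_one₀ zero_le (deviceFactor_le_one κ η p hα x₀ x v)
  -- Averaging over the types at fixed locations leaves a function of the location alone, so only
  -- the Poisson property of the locations is needed.
  set g : Plane → ℝ≥0∞ := fun x => ∑ v, ENNReal.ofReal (f v) * deviceFactor κ η p α x₀ x v ^ k
  have hg : Measurable g := Finset.measurable_sum _ fun v _ =>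
    ((hG.comp measurable_prodMk_right).pow_const k).const_mul _
  have hg1 : ∀ x, g x ≤ 1 := fun x => by
    calc g x ≤ ∑ v, ENNReal.ofReal (f v) := Finset.sum_le_sum fun v _ =>
          mul_le_of_le_one_right' (hG1 x v)
      _ = 1 := by rw [← ENNReal.ofReal_sum_of_nonneg fun v _ => hf v, hf_sum, ENNReal.ofReal_one]
  have hpow : ∀ ω, infProd (fun i => deviceFactor κ η p α x₀ (F.loc i ω) (F.type i ω)) ^ k =
      infProd fun i => deviceFactor κ η p α x₀ (F.loc i ω) (F.type i ω) ^ k := fun ω =>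
    infProd_pow (fun i => deviceFactor_le_one κ η p hα x₀ _ _) k
  have hmeas : Measurable fun q : (ℕ → Plane) × (ℕ → Fin V × Bool × ℝ) =>
      infProd fun i => deviceFactor κ η p α x₀ (q.1 i) (q.2 i).1 ^ k :=
    Measurable.infProd fun i => (hG.comp
      (by fun_prop : Measurable fun q : (ℕ → Plane) × (ℕ → Fin V × Bool × ℝ) =>
        (q.1 i, (q.2 i).1))).pow_const k
  calc ∫⁻ ω, infProd (fun i => deviceFactor κ η p α x₀ (F.loc i ω) (F.type i ω)) ^ k ∂P
      = ∫⁻ x, infProd (fun i => g (x i)) ∂(P.map fun ω i => F.loc i ω) := by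
        simp_rw [hpow]
        refine (lintegral_comp_prodMk_of_indepFun hF.measurable_locs hF.measurable_marks
          hF.indep_loc hmeas).trans (lintegral_congr fun x => ?_)
        have hY := fun i => measurable_deviceFactor_mark_pow κ η p α x₀ (x i) k
        have h := lintegral_infProd_infinitePi
          (fun i => P.map fun ω => (F.type i ω, F.active i ω, F.gain i ω)) hY fun i z => hG1 _ _
        rw [hF.map_marks]
        refine h.trans ?_
        exact congrArg infProd (funext fun i =>
          hF.lintegral_deviceFactor_pow hf hα κ η p x₀ (x i) k i)
    _ = ∫⁻ ω, infProd (fun i => g (F.loc i ω)) ∂P :=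
        lintegral_map (Measurable.infProd fun i => hg.comp (measurable_pi_apply i))
          hF.measurable_locs
    _ = negExp (∫⁻ x, (1 - g x) ∂(ENNReal.ofReal lam • (volume : Measure Plane))) :=
        hF.lintegral_infProd_loc hg hg1

end IsPoissonRayleigh

/-- By the exponential Laplace transform the factor is α / (1 + c ‖x‖^(-η)) + 1 - α, with c = θ (p_v
/ p₀) ‖x₀‖^η. The two excluded points form a null set. -/
lemma deviceFactor_eq_successProb {p₀ θ : ℝ} (hp₀ : 0 < p₀) (hθ : 0 < θ) (hp : ∀ v, 0 < p v)
    (hα : ∀ v, α v ∈ Set.Icc (0 : ℝ) 1) (hx₀ : x₀ ≠ 0) {x : Plane} (hx : x ≠ 0) (hxx₀ : x ≠ x₀)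
    (v : Fin V) :
    deviceFactor (ENNReal.ofReal θ / (ENNReal.ofReal p₀ * ‖x₀‖ₑ ^ (-η))) η p α x₀ x v =
      ENNReal.ofReal (successProb η (θ * (p v / p₀) * ‖x₀‖ ^ η) (α v) x) := by
  have hnx : 0 < ‖x‖ := norm_pos_iff.2 hx
  have hnx₀ : 0 < ‖x₀‖ := norm_pos_iff.2 hx₀
  have hpv := hp v
  have hα0 := (hα v).1
  have hα1 := (hα v).2
  have hc : ENNReal.ofReal θ / (ENNReal.ofReal p₀ * ‖x₀‖ₑ ^ (-η)) * ENNReal.ofReal (p v) *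
      ‖x‖ₑ ^ (-η) = ENNReal.ofReal (θ * (p v / p₀) * ‖x₀‖ ^ η / ‖x‖ ^ η) := by
    rw [← ofReal_norm, ← ofReal_norm, ENNReal.ofReal_rpow_of_pos hnx,
      ENNReal.ofReal_rpow_of_pos hnx₀, ← ENNReal.ofReal_mul hp₀.le,
      ← ENNReal.ofReal_div_of_pos (by positivity), ← ENNReal.ofReal_mul (by positivity),
      ← ENNReal.ofReal_mul (by positivity), Real.rpow_neg hnx.le, Real.rpow_neg hnx₀.le]
    congr 1
    field_simp
  rw [deviceFactor, if_pos hxx₀, hc, lintegral_negExp_mul_expMeasure_one (by positivity),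
    ← ENNReal.ofReal_mul hα0, ← ENNReal.ofReal_add (by positivity) (by linarith), successProb]
  congr 1
  have h1 : 0 < ‖x‖ ^ η := by positivity
  have h2 : 0 < ‖x₀‖ ^ η := by positivity
  field_simp
  ring

end InterferenceField

lemma rpow_two_div_mul {θ q R η : ℝ} (hθ : 0 < θ) (hq : 0 < q) (hR : 0 < R) (hη : η ≠ 0) :
    (θ * q * R ^ η) ^ (2 / η) = θ ^ (2 / η) * q ^ (2 / η) * R ^ 2 := by
  rw [Real.mul_rpow (by positivity) (by positivity), Real.mul_rpow hθ.le hq.le,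
    ← Real.rpow_mul hR.le, mul_div_cancel₀ _ hη, Real.rpow_two]

end

/-! ### Moments of the success probability and their closed forms. -/

noncomputable section

namespace InterferenceField.IsPoissonRayleigh

variable {V : ℕ} {Ω : Type*} [MeasurableSpace Ω] {F : InterferenceField Ω V} {P : Measure Ω}
  {lam : ℝ} {f α p : Fin V → ℝ} {η : ℝ} {x₀ : Plane}

/-- The moments of the fragment success delivery probability, as an exponential of integrals
over the plane. -/
theorem moment_fsdProb [IsProbabilityMeasure P] (hF : F.IsPoissonRayleigh P lam f α)
    (hlam : 0 < lam) (hf : ∀ v, 0 ≤ f v) (hf_sum : ∑ v, f v = 1)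
    (hα : ∀ v, α v ∈ Set.Icc (0 : ℝ) 1) (hp : ∀ v, 0 < p v) {p₀ θ : ℝ} (hp₀ : 0 < p₀)
    (hθ : 0 < θ) (hx₀ : x₀ ≠ 0) (k : ℕ)
    (hint : ∀ v, Integrable fun x =>
      1 - successProb η (θ * (p v / p₀) * ‖x₀‖ ^ η) (α v) x ^ k) :
    moment (F.fsdProb P η p p₀ x₀ θ) k P = Real.exp (-(lam * ∑ v, f v *
      ∫ x, (1 - successProb η (θ * (p v / p₀) * ‖x₀‖ ^ η) (α v) x ^ k))) := by
  have hG := measurable_deviceFactor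
    (ENNReal.ofReal θ / (ENNReal.ofReal p₀ * ‖x₀‖ₑ ^ (-η))) η p α x₀
  have hfac := fun x hx hxx₀ => deviceFactor_eq_successProb (η := η) hp₀ hθ hp hα hx₀
    (x := x) hx hxx₀
  have hae := hF.fsdProb_ae_eq (θ := θ) hf hα hp₀ hx₀ η p
  generalize ENNReal.ofReal θ / (ENNReal.ofReal p₀ * ‖x₀‖ₑ ^ (-η)) = κ at hG hfac hae
  have hs : ∀ v x, successProb η (θ * (p v / p₀) * ‖x₀‖ ^ η) (α v) x ∈ Set.Icc (0 : ℝ) 1 :=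
    fun v x => by
      have := hp v
      have := norm_pos_iff.2 hx₀
      exact successProb_mem (by positivity) (hα v) x
  generalize hsv : (fun v x => successProb η (θ * (p v / p₀) * ‖x₀‖ ^ η) (α v) x) = s
  have hsv' : ∀ v x, successProb η (θ * (p v / p₀) * ‖x₀‖ ^ η) (α v) x = s v x :=
    fun v x => congrFun (congrFun hsv v) x
  simp only [hsv'] at hs hfac hint ⊢
  have hspow : ∀ v x, s v x ^ k ∈ Set.Icc (0 : ℝ) 1 := fun v x =>
    ⟨pow_nonneg (hs v x).1 k, pow_le_one₀ (hs v x).1 (hs v x).2⟩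
  have hterm : ∀ v x, 0 ≤ f v * (1 - s v x ^ k) := fun v x =>
    mul_nonneg (hf v) (sub_nonneg.2 (hspow v x).2)
  have hintegral : ∫⁻ x, (1 - ∑ v, ENNReal.ofReal (f v) * deviceFactor κ η p α x₀ x v ^ k)
      ∂(ENNReal.ofReal lam • (volume : Measure Plane)) =
      ENNReal.ofReal (lam * ∑ v, f v * ∫ x, (1 - s v x ^ k)) := by
    rw [lintegral_smul_measure, smul_eq_mul, ENNReal.ofReal_mul hlam.le]
    simp_rw [← integral_const_mul]
    rw [← integral_finsetSum _ fun v _ => (hint v).const_mul _,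
      ofReal_integral_eq_lintegral_ofReal
        (integrable_finsetSum _ fun v _ => (hint v).const_mul _)
        (ae_of_all _ fun x => Finset.sum_nonneg fun v _ => hterm v x)]
    congr 1
    have h0 : ∀ᵐ x : Plane, x ≠ 0 := by simp [ae_iff]
    have hx : ∀ᵐ x : Plane, x ≠ x₀ := by simp [ae_iff]
    refine lintegral_congr_ae ?_
    filter_upwards [h0, hx] with x h0 hx
    have h1 : ∀ v, ENNReal.ofReal (f v) * deviceFactor κ η p α x₀ x v ^ k =
        ENNReal.ofReal (f v * s v x ^ k) := fun v => by
      rw [hfac x h0 hx v, ENNReal.ofReal_mul (hf v), ENNReal.ofReal_pow (hs v x).1]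
    simp_rw [h1]
    rw [← ENNReal.ofReal_sum_of_nonneg fun v _ => mul_nonneg (hf v) (hspow v x).1,
      ← ENNReal.ofReal_one, ← ENNReal.ofReal_sub _
        (Finset.sum_nonneg fun v _ => mul_nonneg (hf v) (hspow v x).1)]
    congr 1
    -- Because the weights sum to 1, 1 - ∑ f(v) s_v^k = ∑ f(v) (1 - s_v^k).
    simp_rw [mul_sub, mul_one, Finset.sum_sub_distrib, hf_sum]
  have hmom := hF.lintegral_infProd_deviceFactor_pow hf hf_sum hα κ η p x₀ k
  rw [hintegral, negExp_ofReal (mul_nonneg hlam.le (Finset.sum_nonneg fun v _ =>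
    mul_nonneg (hf v) (integral_nonneg fun x => sub_nonneg.2 (hspow v x).2)))] at hmom
  have hmeas : Measurable fun ω =>
      infProd (fun i => deviceFactor κ η p α x₀ (F.loc i ω) (F.type i ω)) ^ k :=
    (Measurable.infProd fun i => hG.comp ((hF.measurable_loc i).prodMk
      (hF.measurable_type i))).pow_const k
  rw [moment, ← ENNReal.toReal_ofReal (Real.exp_pos _).le, ← hmom,
    ← integral_toReal hmeas.aemeasurable
      (ae_of_all _ fun ω => (pow_le_one₀ zero_le (infProd_le_one _)).trans_lt ENNReal.one_lt_top)]
  refine integral_congr_ae ?_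
  filter_upwards [hae] with ω hω
  rw [Pi.pow_apply, hω, ENNReal.toReal_pow]

end InterferenceField.IsPoissonRayleigh

end

theorem mainTheorem2 {Ω : Type*} [MeasurableSpace Ω] (P : Measure Ω) [IsProbabilityMeasure P]
    (V : ℕ) (lam : ℝ) (hlam : 0 < lam)
    (f α p : Fin V → ℝ) (hf : ∀ v, 0 ≤ f v) (hf_sum : ∑ v, f v = 1)
    (hα : ∀ v, α v ∈ Set.Icc (0 : ℝ) 1) (hp : ∀ v, 0 < p v)
    (η : ℝ) (hη : 2 < η) (p₀ : ℝ) (hp₀ : 0 < p₀) (θ : ℝ) (hθ : 0 < θ)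
    (R₀ : ℝ) (hR₀ : 0 < R₀) (x₀ : Plane) (hx₀ : ‖x₀‖ = R₀)
    (F : InterferenceField Ω V) (hF : F.IsPoissonRayleigh P lam f α) :
    moment (F.fsdProb P η p p₀ x₀ θ) 1 P =
      Real.exp (-(2 * Real.pi ^ 2 * R₀ ^ 2 * θ ^ (2 / η)) / (η * Real.sin (2 * Real.pi / η)) *
        ∑ v, (p v / p₀) ^ (2 / η) * (f v * lam) * α v) ∧
    moment (F.fsdProb P η p p₀ x₀ θ) 2 P =
      Real.exp (-(2 * Real.pi ^ 2 * R₀ ^ 2 * θ ^ (2 / η)) / (η * Real.sin (2 * Real.pi / η)) *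
        ∑ v, (p v / p₀) ^ (2 / η) * (f v * lam) * α v * (2 - α v * (1 - 2 / η))) := by
  subst hx₀
  have hx₀ : x₀ ≠ 0 := norm_pos_iff.1 hR₀
  have hη0 : η ≠ 0 := by linarith
  have hq : ∀ v, 0 < p v / p₀ := fun v => div_pos (hp v) hp₀
  have hc : ∀ v, 0 < θ * (p v / p₀) * ‖x₀‖ ^ η := fun v => by
    have := hq v
    positivity
  constructor
  · rw [hF.moment_fsdProb hlam hf hf_sum hα hp hp₀ hθ hx₀ 1 fun v => by
      simpa only [pow_one] using integrable_one_sub_successProb hη (hc v) (α v)]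
    simp only [pow_one, integral_one_sub_successProb hη (hc _)]
    simp only [fun v => rpow_two_div_mul hθ (hq v) hR₀ hη0, Finset.mul_sum]
    rw [← Finset.sum_neg_distrib]
    congr 1
    exact Finset.sum_congr rfl fun v _ => by ring
  · rw [hF.moment_fsdProb hlam hf hf_sum hα hp hp₀ hθ hx₀ 2 fun v =>
      integrable_one_sub_successProb_sq hη (hc v) (α v)]
    simp only [integral_one_sub_successProb_sq hη (hc _)]
    simp only [fun v => rpow_two_div_mul hθ (hq v) hR₀ hη0, Finset.mul_sum]
    rw [← Finset.sum_neg_distrib]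
    congr 1
    exact Finset.sum_congr rfl fun v _ => by ring
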